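/- Let $\xi$ be a random variable with $\mathbb E\,\xi=0$ and $\mathbb E\,\xi^2=1$, and let $(\xi_{i,j})_{i,j\ge 1}$ and $(\xi_i)_{i\ge1}$ be (each) families of independent copies of $\xi$. For $d\in\mathbb N$ let $$X_i^{(d)}=\frac{(\xi_{i,1},\dots,\xi_{i,d})}{\sqrt d}\in\mathbb R^d,\qquad S_n^{(d)}=X_1^{(d)}+\dots+X_n^{(d)},$$ and let $\|\cdot\|$ be the Euclidean norm. Suppose that for some $\alpha\in(1,2)$ $$\frac{\xi_1^2+\dots+\xi_m^2-m}{m^{1/\alpha}L(m)}\ \xrightarrow{\ w\ }\ \zeta_\alpha\qquad(m\to\infty),$$ where $L$ is a slowly varying function (that is, $L$ is positive and measurable on some half-line $[a,\infty)$ and $L(cx)/L(x)\to1$ as $x\to\infty$ for every $c>0$) and $\zeta_\alpha$ is a zero-mean random variable with a (non-degenerate) spectrally positive $\alpha$-stable distribution (that is, its characteristic function is $t\mapsto\exp\{-\sigma^\alpha|t|^\alpha(1-i\,\mathrm{sign}(t)\tan(\pi\alpha/2))+ibt\}$ for some $\sigma>0$ and $b\in\mathbb R$). Let $n=n(d)$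 be a sequence of positive integers with $n(d)\to\infty$ as $d\to\infty$. (a) If for some $\delta>0$ we have $n>d^{\frac{2-\alpha}{2\alpha-2}+\delta}$ for all sufficiently large $d$, then $$\frac{\|S_n^{(d)}\|^2-n}{\sqrt{2n^2/d}}\ \xrightarrow{\ w\ }\ \mathrm N(0,1)\qquad(d\to\infty).$$ (b) If for some $\delta>0$ we have $n<d^{\frac{2-\alpha}{2\alpha-2}-\delta}$ for all sufficiently large $d$, then $$\frac{\|S_n^{(d)}\|^2-n}{d^{-1}(nd)^{1/\alpha}L(nd)}\ \xrightarrow{\ w\ }\ \zeta_\alpha\qquad(d\to\infty).$$ Here $\xrightarrow{w}$ denotes convergence in distribution. -/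

import Mathlib

open MeasureTheory ProbabilityTheory Filter Topology

noncomputable section

/-- A function `L`, positive and measurable on some half-line `[a, ∞)`, is slowly varying (at
infinity) if `L (c x) / L x → 1` as `x → ∞`, for every `c > 0`. The values of `L` outside the
half-line play no role. -/
structure IsSlowlyVarying (L : ℝ → ℝ) : Prop where
  measurable_pos : ∃ a : ℝ, Measurable (fun x : Set.Ici a => L x) ∧ ∀ x ∈ Set.Ici a, 0 < L x
  tendsto_ratio : ∀ c : ℝ, 0 < c → Tendsto (fun x : ℝ => L (c * x) / L x) atTop (𝓝 1)

/-- The (non-degenerate) spectrally positive stable laws of index `α ≠ 1` on the real line: the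
stable laws `S_α(σ, β, b)` with scale `σ > 0`, skewness `β = 1` and arbitrary location `b`,
given by their characteristic function
`exp (-σ^α |t|^α (1 - i sign(t) tan(π α / 2)) + i b t)`. -/
def IsSpectrallyPositiveStable (α : ℝ) (μ : Measure ℝ) : Prop :=
  IsProbabilityMeasure μ ∧ ∃ σ : ℝ, 0 < σ ∧ ∃ b : ℝ, ∀ t : ℝ,
    charFun μ t =
      Complex.exp (-((σ ^ α * |t| ^ α : ℝ) : ℂ) *
          (1 - Complex.I * ((Real.sign t * Real.tan (Real.pi * α / 2) : ℝ) : ℂ)) +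
        Complex.I * ((b * t : ℝ) : ℂ))

/-- The family `X`, defined on `(Ω, P)`, consists of independent copies of the random variable
`ξ`, defined on `(Ω₀, P₀)`. -/
structure IndependentCopies {ι Ω Ω₀ : Type*} [MeasurableSpace Ω] [MeasurableSpace Ω₀]
    (X : ι → Ω → ℝ) (P : Measure Ω) (ξ : Ω₀ → ℝ) (P₀ : Measure Ω₀) : Prop where
  indep : iIndepFun X P
  identDistrib : ∀ i, IdentDistrib (X i) ξ P P₀

/-- The increment `X_i^{(d)} = (ξ_{i,1}, …, ξ_{i,d}) / √d` of the `d`-dimensional random walk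
(all indices start from `0`). -/
def increment {Ω : Type*} (ξ : ℕ × ℕ → Ω → ℝ) (d i : ℕ) (ω : Ω) : EuclideanSpace ℝ (Fin d) :=
  WithLp.toLp 2 fun j : Fin d => ξ (i, (j : ℕ)) ω / √(d : ℝ)

/-- The position `S_n^{(d)}` of the `d`-dimensional random walk after `n` steps. -/
def walk {Ω : Type*} (ξ : ℕ × ℕ → Ω → ℝ) (d n : ℕ) (ω : Ω) : EuclideanSpace ℝ (Fin d) :=
  ∑ i ∈ Finset.range n, increment ξ d i ω

end

/-! Expanding the square of each coordinate gives d(‖S‖² - n) = A + B (`norm_walk_sq`). Here A is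
the centred sum of the nd squares ξ_{i,j}², and B is the sum over the d coordinates of the
off-diagonal products. By assumption A is of order (nd)^{1/α} L(nd) with a stable limit, while B has
variance 2n(n-1)d and is asymptotically normal at scale √2 n √d. The ratio of the scales is, up to L
and constants, n^{1/α-1} d^{1/α-1/2}, which balances exactly at n = d^{(2-α)/(2α-2)}. The margin δ
yields a power of d that beats L (`IsSlowlyVarying.eventually_rpow_bounds`), and Slutsky discards
the smaller term, so the joint law of A and B is never needed.

Normality of B is a triangular-array matter, since n varies with d. One normalized off-diagonal sum
converges to (N² - 1)/√2 with N standard normal, and its second moment 1 - 1/n converges to that of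
the limit. Weak convergence together with convergence of second moments replaces a Lindeberg
condition (`tendsto_charFun_pow_of_tendsto`), so no fourth moment of ξ is required. -/

/-! ### Slowly varying functions -/

/-- **Uniform convergence theorem** for additively slowly varying functions. -/
theorem exists_forall_abs_sub_le_of_tendsto_sub {f : ℝ → ℝ} (hf : Measurable f)
    (h : ∀ u : ℝ, Tendsto (fun x => f (x + u) - f x) atTop (𝓝 0)) {ε : ℝ} (hε : 0 < ε) :
    ∃ X : ℝ, ∀ x, X ≤ x → ∀ u ∈ Set.Icc (0 : ℝ) 1, |f (x + u) - f x| ≤ ε := by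
  by_contra! hcon
  choose x hx u hu hbad using fun n : ℕ => hcon n
  have hxt : Tendsto x atTop atTop := tendsto_atTop_mono hx tendsto_natCast_atTop_atTop
  have hyt : Tendsto (fun n => x n + u n) atTop atTop :=
    tendsto_atTop_mono (fun n => le_add_of_nonneg_right (hu n).1) hxt
  -- Pointwise convergence on a set of finite measure gives convergence in measure. The window [0,
  -- 2] is needed because `u n + v` ranges over it for v in [0, 1].
  have key (y : ℕ → ℝ) (hy : Tendsto y atTop atTop) :
      ∀ᶠ n in atTop, volume ({w | ε / 2 ≤ |f (y n + w) - f (y n)|} ∩ Set.Icc (0 : ℝ) 2)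
        < ENNReal.ofReal (1 / 2) := by
    have hm : TendstoInMeasure (volume.restrict (Set.Icc (0 : ℝ) 2))
        (fun n w => f (y n + w) - f (y n)) atTop (fun _ => 0) :=
      tendstoInMeasure_of_tendsto_ae
        (fun n => ((hf.comp (measurable_const_add _)).sub measurable_const).aestronglyMeasurable)
        (ae_of_all _ fun w => (h w).comp hy)
    have := (tendstoInMeasure_iff_norm.1 hm (ε / 2) (by positivity)).eventually_lt_const
      (show (0 : ENNReal) < ENNReal.ofReal (1 / 2) by simp)
    filter_upwards [this] with n hn
    rw [Measure.restrict_apply₀'] at hn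
    · simpa using hn
    · exact measurableSet_Icc.nullMeasurableSet
  obtain ⟨n, h1, h2⟩ := ((key x hxt).and (key _ hyt)).exists
  set S := {w | ε / 2 ≤ |f (x n + w) - f (x n)|} ∩ Set.Icc (0 : ℝ) 2 with hS
  set T := {w | ε / 2 ≤ |f (x n + u n + w) - f (x n + u n)|} ∩ Set.Icc (0 : ℝ) 2 with hT
  -- If v avoided both bad sets, the point x + u + v would be within ε/2 in value of both x and x +
  -- u, contradicting `hbad`. So two sets of measure below 1/2 would cover an interval of length 1.
  have hcover : Set.Icc (0 : ℝ) 1 ⊆ ((fun v => u n + v) ⁻¹' S) ∪ T := by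
    intro v hv
    by_contra hnot
    rw [Set.mem_union, not_or] at hnot
    have hu' := hu n
    have a1 : |f (x n + (u n + v)) - f (x n)| < ε / 2 := by
      by_contra! hc
      exact hnot.1 ⟨hc, by constructor <;> linarith [hu'.1, hu'.2, hv.1, hv.2]⟩
    have a2 : |f (x n + u n + v) - f (x n + u n)| < ε / 2 := by
      by_contra! hc
      exact hnot.2 ⟨hc, by constructor <;> linarith [hv.1, hv.2]⟩
    have a3 := hbad n
    rw [← add_assoc] at a1
    rw [abs_lt] at a1 a2
    rw [lt_abs] at a3
    rcases a3 with a3 | a3 <;> linarith [a1.1, a1.2, a2.1, a2.2]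
  have hlt : volume (Set.Icc (0 : ℝ) 1) < ENNReal.ofReal (1 / 2) + ENNReal.ofReal (1 / 2) := by
    calc volume (Set.Icc (0 : ℝ) 1) ≤ volume ((fun v => u n + v) ⁻¹' S) + volume T :=
          (measure_mono hcover).trans (measure_union_le _ _)
      _ = volume S + volume T := by rw [measure_preimage_add]
      _ < _ := ENNReal.add_lt_add h1 h2
  rw [← ENNReal.ofReal_add (by norm_num) (by norm_num)] at hlt
  norm_num at hlt

/-- Uniformity bounds each increment over a step of length at most 1 by ε/2. Telescoping gives slope
ε/2, and the remaining constants are absorbed by doubling the slope. -/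
theorem eventually_abs_le_mul_of_tendsto_sub {f : ℝ → ℝ} (hf : Measurable f)
    (h : ∀ u : ℝ, Tendsto (fun x => f (x + u) - f x) atTop (𝓝 0)) {ε : ℝ} (hε : 0 < ε) :
    ∀ᶠ x in atTop, |f x| ≤ ε * x := by
  obtain ⟨X, hX⟩ := exists_forall_abs_sub_le_of_tendsto_sub hf h (half_pos hε)
  have hnat (n : ℕ) : |f (X + n) - f X| ≤ ε / 2 * n := by
    induction n with
    | zero => simp
    | succ n ih =>
      have := hX (X + n) (by simp) 1 (by simp)
      have h3 := abs_sub_le (f (X + n + 1)) (f (X + n)) (f X)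
      push_cast
      rw [← add_assoc]
      linarith
  have hlin (x : ℝ) (hx : X ≤ x) : |f x - f X| ≤ ε / 2 * (x - X + 1) := by
    have h0 : 0 ≤ x - X := by linarith
    have h1 := Nat.floor_le h0
    have h2 := (Nat.lt_floor_add_one (x - X)).le
    have h3 := hX (X + ⌊x - X⌋₊) (by simp) (x - X - ⌊x - X⌋₊) (by constructor <;> linarith)
    have h4 := hnat ⌊x - X⌋₊
    have h5 := abs_sub_le (f x) (f (X + ⌊x - X⌋₊)) (f X)
    rw [show X + (⌊x - X⌋₊ : ℝ) + (x - X - ⌊x - X⌋₊) = x by ring] at h3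
    nlinarith
  filter_upwards [eventually_ge_atTop X,
    eventually_ge_atTop ((|f X| + ε / 2 * (1 - X)) / (ε / 2))] with x hx hx2
  rw [div_le_iff₀ (by positivity)] at hx2
  have h3 : |f x| ≤ |f x - f X| + |f X| := by simpa using abs_sub_le (f x) (f X) 0
  have := hlin x hx
  linarith

/-- A slowly varying function grows and decays slower than every power. -/
theorem IsSlowlyVarying.eventually_rpow_bounds {L : ℝ → ℝ} (hL : IsSlowlyVarying L) {ε : ℝ}
    (hε : 0 < ε) : ∀ᶠ x in atTop, x ^ (-ε) ≤ L x ∧ L x ≤ x ^ ε := by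
  obtain ⟨a, hmeas, hpos⟩ := hL.measurable_pos
  classical
  -- `L` is measurable only on a half-line; resetting it to 1 elsewhere gives global measurability
  -- without changing the behaviour at infinity.
  let M : ℝ → ℝ := fun x => if x ∈ Set.Ici a then L x else 1
  have hMmeas : Measurable M := by
    refine measurable_of_restrict_of_restrict_compl (s := Set.Ici a) measurableSet_Ici ?_ ?_
    · convert! hmeas with x
      exact if_pos x.2
    · have : (Set.Ici a)ᶜ.domRestrict M = fun _ => 1 := by
        ext x
        exact if_neg x.2
      rw [this]
      exact measurable_const
  have hML (x : ℝ) (hx : a ≤ x) : M x = L x := if_pos hx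
  have hMpos (x : ℝ) (hx : a ≤ x) : 0 < M x := by rw [hML x hx]; exact hpos x hx
  let f : ℝ → ℝ := fun y => Real.log (M (Real.exp y))
  have hf : Measurable f := Real.measurable_log.comp (hMmeas.comp Real.measurable_exp)
  have hslow (u : ℝ) : Tendsto (fun x => f (x + u) - f x) atTop (𝓝 0) := by
    have h1 := (hL.tendsto_ratio (Real.exp u) (Real.exp_pos u)).comp Real.tendsto_exp_atTop
    have h2 := h1.log one_ne_zero
    rw [Real.log_one] at h2
    refine h2.congr' ?_
    have e1 := Real.tendsto_exp_atTop.eventually_ge_atTop a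
    have e2 := (Real.tendsto_exp_atTop.comp
      (tendsto_atTop_add_const_right _ u tendsto_id)).eventually_ge_atTop a
    filter_upwards [e1, e2] with x hx1 hx2
    simp only [Function.comp_apply, id_eq] at hx2 ⊢
    rw [← Real.log_div (hMpos _ hx2).ne' (hMpos _ hx1).ne', hML _ hx1, hML _ hx2, Real.exp_add,
      mul_comm]
  have hfin := Real.tendsto_log_atTop.eventually (eventually_abs_le_mul_of_tendsto_sub hf hslow hε)
  filter_upwards [hfin, eventually_ge_atTop a, eventually_gt_atTop 0] with x hx hxa hx0
  have hp := hpos x hxa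
  simp only [f, Real.exp_log hx0, hML x hxa] at hx
  rw [abs_le] at hx
  constructor
  · rw [Real.rpow_def_of_pos hx0, ← Real.le_log_iff_exp_le hp]
    linarith [hx.1]
  · rw [Real.rpow_def_of_pos hx0, ← Real.log_le_iff_le_exp hp]
    linarith [hx.2]

/-! ### Tools for convergence in distribution -/

/-- A sequence that converges in distribution, multiplied by constants tending to zero, converges
to zero in probability. -/
theorem MeasureTheory.TendstoInDistribution.tendstoInMeasure_mul_zero {Ω Ω' : Type*}
    [MeasurableSpace Ω] [MeasurableSpace Ω'] {P : Measure Ω} {P' : Measure Ω'}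
    [IsProbabilityMeasure P] [IsProbabilityMeasure P'] {Y : ℕ → Ω → ℝ} {Z : Ω' → ℝ}
    (hY : TendstoInDistribution Y atTop Z (fun _ => P) P') {c : ℕ → ℝ}
    (hc : Tendsto c atTop (𝓝 0)) :
    TendstoInMeasure P (fun n ω => c n * Y n ω) atTop (fun _ => 0) := by
  have hcm : TendstoInMeasure P (fun n (_ : Ω) => c n) atTop (fun _ => (0 : ℝ)) :=
    tendstoInMeasure_of_tendsto_ae (fun n => aestronglyMeasurable_const) (ae_of_all _ fun _ => hc)
  have h := hY.continuous_comp_prodMk_of_tendstoInMeasure_const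
    (g := fun p : ℝ × ℝ => p.2 * p.1) (by fun_prop) hcm (fun _ => aemeasurable_const)
  rw [tendstoInMeasure_iff_measureReal_norm]
  intro ε hε
  -- This test function vanishes at 0 and equals 1 where |x| ≥ ε, so its integral dominates the tail
  -- probability.
  let φ : BoundedContinuousFunction ℝ ℝ := BoundedContinuousFunction.ofNormedAddCommGroup
    (fun x => min (|x| / ε) 1) (by fun_prop) 1 (fun x => by
      rw [Real.norm_of_nonneg (by positivity)]; exact min_le_right _ _)
  have hφ := (ProbabilityMeasure.tendsto_iff_forall_integral_tendsto.1 h.tendsto) φ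
  have hm (n : ℕ) : AEMeasurable (fun ω => c n * Y n ω) P :=
    (hY.forall_aemeasurable n).const_mul _
  simp only [ProbabilityMeasure.coe_mk, zero_mul] at hφ
  rw [integral_map aemeasurable_const φ.continuous.aestronglyMeasurable] at hφ
  have hφ0 : φ 0 = 0 := by simp [φ]
  simp only [hφ0, integral_zero] at hφ
  refine squeeze_zero (fun _ => measureReal_nonneg) (fun n => ?_) hφ
  rw [integral_map (hm n) φ.continuous.aestronglyMeasurable]
  have hint : Integrable (fun ω => φ (c n * Y n ω)) P :=
    (φ.integrable (P.map _)).comp_aemeasurable (hm n)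
  have h1 := mul_meas_ge_le_integral_of_nonneg (μ := P) (f := fun ω => φ (c n * Y n ω))
    (ae_of_all _ fun ω => le_min (by positivity) zero_le_one) hint 1
  rw [one_mul] at h1
  refine le_trans (measureReal_mono ?_) h1
  intro ω hω
  simp only [Set.mem_ofPred_eq, sub_zero, Real.norm_eq_abs] at hω
  change 1 ≤ min (|c n * Y n ω| / ε) 1
  exact le_min ((one_le_div hε).2 hω) le_rfl

/-- **Slutsky's lemma** for the sum of a convergent sequence and a negligible multiple of another
convergent sequence. -/
theorem MeasureTheory.TendstoInDistribution.of_eventually_eq_add_mul {Ω Ω₁ Ω₂ : Type*}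
    [MeasurableSpace Ω] [MeasurableSpace Ω₁] [MeasurableSpace Ω₂] {P : Measure Ω}
    {P₁ : Measure Ω₁} {P₂ : Measure Ω₂} [IsProbabilityMeasure P] [IsProbabilityMeasure P₁]
    [IsProbabilityMeasure P₂] {X Y W : ℕ → Ω → ℝ} {Z₁ : Ω₁ → ℝ} {Z₂ : Ω₂ → ℝ}
    (hX : TendstoInDistribution X atTop Z₁ (fun _ => P) P₁)
    (hY : TendstoInDistribution Y atTop Z₂ (fun _ => P) P₂) {c : ℕ → ℝ}
    (hc : Tendsto c atTop (𝓝 0)) (hW : ∀ n, AEMeasurable (W n) P)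
    (hWXY : ∀ᶠ n in atTop, ∀ ω, W n ω = X n ω + c n * Y n ω) :
    TendstoInDistribution W atTop Z₁ (fun _ => P) P₁ := by
  refine tendstoInDistribution_of_tendstoInMeasure_sub W Z₁ hX ?_ hW
  refine (hY.tendstoInMeasure_mul_zero hc).congr' ?_ (ae_of_all _ fun _ => rfl)
  filter_upwards [hWXY] with n hn
  exact ae_of_all _ fun ω => by simp [hn ω]

/-- Convergence in distribution only depends on the laws of the random variables. -/
theorem MeasureTheory.TendstoInDistribution.of_map_eq {Ω₁ Ω₂ Ω' : Type*} [MeasurableSpace Ω₁]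
    [MeasurableSpace Ω₂] [MeasurableSpace Ω'] {P₁ : Measure Ω₁} {P₂ : Measure Ω₂}
    {P' : Measure Ω'} [IsProbabilityMeasure P₁] [IsProbabilityMeasure P₂] [IsProbabilityMeasure P']
    {X : ℕ → Ω₁ → ℝ} {Y : ℕ → Ω₂ → ℝ} {Z : Ω' → ℝ}
    (hX : TendstoInDistribution X atTop Z (fun _ => P₁) P')
    (hXY : ∀ n, IdentDistrib (Y n) (X n) P₂ P₁) :
    TendstoInDistribution Y atTop Z (fun _ => P₂) P' where
  forall_aemeasurable n := (hXY n).aemeasurable_fst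
  aemeasurable_limit := hX.aemeasurable_limit
  tendsto := by
    refine hX.tendsto.congr fun n => ?_
    exact Subtype.ext (hXY n).map_eq.symm

/-- Reindexing of a sequence that converges in distribution. -/
theorem MeasureTheory.TendstoInDistribution.comp_tendsto {Ω Ω' : Type*} [MeasurableSpace Ω]
    [MeasurableSpace Ω'] {P : Measure Ω} {P' : Measure Ω'} [IsProbabilityMeasure P]
    [IsProbabilityMeasure P'] {X : ℕ → Ω → ℝ} {Z : Ω' → ℝ}
    (hX : TendstoInDistribution X atTop Z (fun _ => P) P') {k : ℕ → ℕ}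
    (hk : Tendsto k atTop atTop) :
    TendstoInDistribution (fun n => X (k n)) atTop Z (fun _ => P) P' where
  forall_aemeasurable n := hX.forall_aemeasurable (k n)
  aemeasurable_limit := hX.aemeasurable_limit
  tendsto := hX.tendsto.comp hk

/-! ### A central limit theorem for triangular arrays -/

/-- The cubic bound comes from the exponential series for |y| ≤ 1, the quadratic one from the
triangle inequality for |y| > 1. The minimum is smaller than second order near 0 yet integrable with
two moments only. -/
theorem norm_exp_mul_I_sub_taylor_two_le (y : ℝ) :
    ‖Complex.exp (y * Complex.I) - 1 - y * Complex.I + (y : ℂ) ^ 2 / 2‖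
      ≤ 4 * min (|y| ^ 3) (y ^ 2) := by
  have hnorm : ‖(y : ℂ) * Complex.I‖ = |y| := by simp
  rcases le_or_gt |y| 1 with h | h
  · have h1 := Complex.exp_bound (x := (y : ℂ) * Complex.I) (by rw [hnorm]; exact h)
      (n := 3) (by norm_num)
    have e : Complex.exp (y * Complex.I) - 1 - y * Complex.I + (y : ℂ) ^ 2 / 2
        = Complex.exp (y * Complex.I)
          - ∑ m ∈ Finset.range 3, ((y : ℂ) * Complex.I) ^ m / (m.factorial : ℂ) := by
      simp [Finset.sum_range_succ, Nat.factorial, mul_pow]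
      ring
    rw [e]
    refine h1.trans ?_
    rw [hnorm]
    have hy3 : |y| ^ 3 ≤ y ^ 2 := by
      rw [← sq_abs]
      exact pow_le_pow_of_le_one (abs_nonneg y) h (by norm_num)
    rw [min_eq_left hy3, mul_comm]
    have : 0 ≤ |y| ^ 3 := by positivity
    norm_num [Nat.factorial]
    linarith
  · have hy3 : y ^ 2 ≤ |y| ^ 3 := by
      rw [← sq_abs]
      exact pow_le_pow_right₀ h.le (by norm_num)
    rw [min_eq_right hy3]
    have h1 : ‖Complex.exp (y * Complex.I) - 1 - y * Complex.I + (y : ℂ) ^ 2 / 2‖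
        ≤ 1 + 1 + |y| + y ^ 2 / 2 := by
      refine (norm_add_le _ _).trans (add_le_add ((norm_sub_le _ _).trans
        (add_le_add ((norm_sub_le _ _).trans (add_le_add ?_ ?_)) ?_)) ?_)
      · rw [Complex.norm_exp_ofReal_mul_I]
      · simp
      · rw [hnorm]
      · simp
    nlinarith [sq_abs y]

/-- Split at |x| = 2K: beyond it, min(x², K²) ≤ x²/4, whence the factor 4/3. Truncating by a minimum
rather than an indicator keeps the truncated square a bounded continuous test function. -/
theorem min_abs_pow_three_sq_le {x s K : ℝ} (hs : 0 ≤ s) (hK : 0 ≤ K) :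
    min (s * |x| ^ 3) (x ^ 2) ≤ 2 * K * s * x ^ 2 + 4 / 3 * (x ^ 2 - min (x ^ 2) (K ^ 2)) := by
  have hx := abs_nonneg x
  have h0 : 0 ≤ x ^ 2 - min (x ^ 2) (K ^ 2) := sub_nonneg.2 (min_le_left _ _)
  rcases le_or_gt |x| (2 * K) with h | h
  · refine (min_le_left _ _).trans ?_
    have : s * |x| ^ 3 ≤ 2 * K * s * x ^ 2 := by
      rw [← sq_abs x]
      have : 0 ≤ s * |x| ^ 2 := by positivity
      nlinarith
    linarith
  · refine (min_le_right _ _).trans ?_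
    have h2 : 4 * K ^ 2 ≤ x ^ 2 := by
      rw [← sq_abs x]
      nlinarith
    have h3 : min (x ^ 2) (K ^ 2) ≤ K ^ 2 := min_le_right _ _
    have : 0 ≤ 2 * K * s * x ^ 2 := by positivity
    linarith

/-- Second order expansion of the characteristic function of a centred law, with an explicit
error term. -/
theorem norm_charFun_sub_taylor_two_le {μ : Measure ℝ} [IsProbabilityMeasure μ]
    (h2 : MemLp id 2 μ) (h0 : ∫ x, x ∂μ = 0) (s : ℝ) {K : ℝ} (hK : 0 ≤ K) :
    ‖charFun μ s - 1 + (s : ℂ) ^ 2 / 2 * ((∫ x, x ^ 2 ∂μ : ℝ) : ℂ)‖ ≤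
      4 * s ^ 2 * (2 * K * |s| * ∫ x, x ^ 2 ∂μ
        + 4 / 3 * (∫ x, x ^ 2 ∂μ - ∫ x, min (x ^ 2) (K ^ 2) ∂μ)) := by
  have hi1 : Integrable (fun x : ℝ => x) μ := h2.integrable (by norm_num)
  have hi2 : Integrable (fun x : ℝ => x ^ 2) μ := h2.integrable_sq
  have hi3 : Integrable (fun x : ℝ => min (x ^ 2) (K ^ 2)) μ :=
    hi2.inf (integrable_const _)
  have hie : Integrable (fun x : ℝ => Complex.exp ((s * x : ℝ) * Complex.I)) μ :=
    Integrable.of_bound (by fun_prop) 1 (ae_of_all _ fun x => by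
      rw [Complex.norm_exp_ofReal_mul_I])
  have hic : Integrable (fun x : ℝ => ((s * x : ℝ) : ℂ) * Complex.I) μ :=
    (hi1.const_mul s).ofReal.mul_const _
  have hiq : Integrable (fun x : ℝ => ((s * x : ℝ) : ℂ) ^ 2 / 2) μ := by
    have := (((hi2.const_mul (s ^ 2)).div_const 2).ofReal (𝕜 := ℂ))
    refine this.congr (ae_of_all _ fun x => ?_)
    simp [mul_pow]
  have hA : Integrable (fun x : ℝ => Complex.exp ((s * x : ℝ) * Complex.I) - 1) μ :=
    hie.sub (integrable_const _)
  have hB : Integrable (fun x : ℝ => Complex.exp ((s * x : ℝ) * Complex.I) - 1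
      - ((s * x : ℝ) : ℂ) * Complex.I) μ := hA.sub hic
  have hC : Integrable (fun x : ℝ => x ^ 2 - min (x ^ 2) (K ^ 2)) μ := hi2.sub hi3
  have heq : charFun μ s - 1 + (s : ℂ) ^ 2 / 2 * ((∫ x, x ^ 2 ∂μ : ℝ) : ℂ)
      = ∫ x, (Complex.exp ((s * x : ℝ) * Complex.I) - 1 - ((s * x : ℝ) : ℂ) * Complex.I
          + ((s * x : ℝ) : ℂ) ^ 2 / 2) ∂μ := by
    rw [integral_add hB hiq, integral_sub hA hic, integral_sub hie (integrable_const _)]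
    have e1 : ∫ x, ((s * x : ℝ) : ℂ) * Complex.I ∂μ = 0 := by
      rw [integral_mul_const, integral_complex_ofReal, integral_const_mul, h0]
      simp
    have e2 : ∫ x, ((s * x : ℝ) : ℂ) ^ 2 / 2 ∂μ
        = (s : ℂ) ^ 2 / 2 * ((∫ x, x ^ 2 ∂μ : ℝ) : ℂ) := by
      rw [← integral_complex_ofReal, ← integral_const_mul]
      congr with x
      push_cast
      ring
    rw [e1, e2, charFun_apply_real]
    simp
  rw [heq]
  refine (norm_integral_le_integral_norm _).trans ?_
  calc ∫ x, ‖Complex.exp ((s * x : ℝ) * Complex.I) - 1 - ((s * x : ℝ) : ℂ) * Complex.I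
          + ((s * x : ℝ) : ℂ) ^ 2 / 2‖ ∂μ
      ≤ ∫ x, 4 * s ^ 2 * (2 * K * |s| * x ^ 2 + 4 / 3 * (x ^ 2 - min (x ^ 2) (K ^ 2))) ∂μ := by
        refine integral_mono (hB.add hiq).norm
          (((hi2.const_mul _).add (hC.const_mul _)).const_mul _) fun x => ?_
        refine (norm_exp_mul_I_sub_taylor_two_le (s * x)).trans ?_
        have h1 : min (|s * x| ^ 3) ((s * x) ^ 2) = s ^ 2 * min (|s| * |x| ^ 3) (x ^ 2) := by
          rw [mul_min_of_nonneg _ _ (sq_nonneg s), abs_mul, mul_pow, mul_pow, ← mul_assoc,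
            ← sq_abs s, pow_succ |s| 2]
        rw [h1, ← mul_assoc]
        exact mul_le_mul_of_nonneg_left (min_abs_pow_three_sq_le (abs_nonneg s) hK)
          (by positivity)
    _ = _ := by
        rw [integral_const_mul, integral_add (hi2.const_mul _) (hC.const_mul _),
          integral_const_mul, integral_const_mul, integral_sub hi2 hi3]

/-- **Central limit theorem for triangular arrays** with identically distributed rows whose laws
converge weakly together with their second moments, in terms of characteristic functions. -/
theorem tendsto_charFun_pow_of_tendsto {μ : ℕ → ProbabilityMeasure ℝ} {ν : ProbabilityMeasure ℝ}
    (hμ : Tendsto μ atTop (𝓝 ν)) (h2 : ∀ d, MemLp id 2 (μ d : Measure ℝ))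
    (h0 : ∀ d, ∫ x, x ∂(μ d : Measure ℝ) = 0)
    (hvar : Tendsto (fun d => ∫ x, x ^ 2 ∂(μ d : Measure ℝ)) atTop (𝓝 1))
    (hν2 : MemLp id 2 (ν : Measure ℝ)) (hν : ∫ x, x ^ 2 ∂(ν : Measure ℝ) = 1) (t : ℝ) :
    Tendsto (fun d : ℕ => charFun (μ d : Measure ℝ) ((√d)⁻¹ * t) ^ d) atTop
      (𝓝 (Complex.exp (-(t : ℂ) ^ 2 / 2))) := by
  have hsmall : Tendsto (fun d : ℕ => (d : ℝ) * ‖charFun (μ d : Measure ℝ) ((√d)⁻¹ * t) - 1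
      + (((√d)⁻¹ * t : ℝ) : ℂ) ^ 2 / 2 * ((∫ x, x ^ 2 ∂(μ d : Measure ℝ) : ℝ) : ℂ)‖)
      atTop (𝓝 0) := by
    let tail (ρ : Measure ℝ) (K : ℝ) : ℝ := ∫ x, x ^ 2 ∂ρ - ∫ x, min (x ^ 2) (K ^ 2) ∂ρ
    have htail (K : ℝ) : Tendsto (fun d => tail (μ d) K) atTop (𝓝 (tail ν K)) := by
      simp only [tail]
      rw [hν]
      refine hvar.sub ?_
      let φ : BoundedContinuousFunction ℝ ℝ := BoundedContinuousFunction.ofNormedAddCommGroup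
        (fun x => min (x ^ 2) (K ^ 2)) (by fun_prop) (K ^ 2) (fun x => by
          rw [Real.norm_of_nonneg (by positivity)]; exact min_le_right _ _)
      exact (ProbabilityMeasure.tendsto_iff_forall_integral_tendsto.1 hμ) φ
    have htail0 : Tendsto (fun K : ℕ => tail ν K) atTop (𝓝 0) := by
      have hlim : Tendsto (fun K : ℕ => ∫ x, min (x ^ 2) ((K : ℝ) ^ 2) ∂(ν : Measure ℝ)) atTop
          (𝓝 (∫ x, x ^ 2 ∂(ν : Measure ℝ))) := by
        refine tendsto_integral_of_dominated_convergence (fun x => x ^ 2)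
          (fun K => Continuous.aestronglyMeasurable (by fun_prop)) hν2.integrable_sq
          (fun K => ae_of_all _ fun x => ?_) (ae_of_all _ fun x => ?_)
        · rw [Real.norm_of_nonneg (by positivity)]
          exact min_le_left _ _
        · refine tendsto_const_nhds.congr' ?_
          filter_upwards [eventually_ge_atTop ⌈|x|⌉₊] with K hK
          rw [min_eq_left]
          exact sq_le_sq.2 ((Nat.ceil_le.1 hK).trans (le_abs_self _))
      have h3 := hlim.const_sub (∫ x, x ^ 2 ∂(ν : Measure ℝ))
      rw [sub_self] at h3
      exact h3
    rw [Metric.tendsto_atTop']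
    intro ε hε
    -- The truncation level K is fixed first, from the tail of the limit law; only then does d grow.
    -- The `+ 1` covers t = 0.
    have hc : 0 < ε / (4 * t ^ 2 * (4 / 3) + 1) := by positivity
    obtain ⟨K, hK⟩ := (htail0.eventually_lt_const hc).exists
    have hbound : Tendsto (fun d : ℕ => 4 * t ^ 2 * (2 * K * |(√d)⁻¹ * t|
        * ∫ x, x ^ 2 ∂(μ d : Measure ℝ) + 4 / 3 * tail (μ d) K)) atTop
        (𝓝 (4 * t ^ 2 * (2 * K * |0 * t| * 1 + 4 / 3 * tail ν K))) := by
      have hs : Tendsto (fun d : ℕ => (√(d : ℝ))⁻¹) atTop (𝓝 0) :=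
        tendsto_inv_atTop_zero.comp (Real.tendsto_sqrt_atTop.comp tendsto_natCast_atTop_atTop)
      exact ((((hs.mul_const t).abs.const_mul _).mul hvar).add ((htail K).const_mul _)).const_mul _
    have hlt : 4 * t ^ 2 * (2 * K * |0 * t| * 1 + 4 / 3 * tail ν K) < ε := by
      rw [lt_div_iff₀ (by positivity)] at hK
      have h1 : 0 ≤ tail ν K := sub_nonneg.2 <| integral_mono
        (hν2.integrable_sq.inf (integrable_const _)) hν2.integrable_sq fun x => min_le_left _ _
      simp only [zero_mul, abs_zero, mul_zero, zero_add]
      nlinarith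
    obtain ⟨N, hN⟩ := eventually_atTop.1
      ((hbound.eventually_lt_const hlt).and (eventually_gt_atTop 0))
    refine ⟨N, fun d hd => ?_⟩
    obtain ⟨h1, hd0⟩ := hN d hd.le
    have hd0' : (0 : ℝ) < d := by exact_mod_cast hd0
    rw [Real.dist_eq, sub_zero, abs_of_nonneg (by positivity)]
    refine lt_of_le_of_lt ?_ h1
    refine (mul_le_mul_of_nonneg_left (norm_charFun_sub_taylor_two_le (h2 d) (h0 d) ((√d)⁻¹ * t)
      (Nat.cast_nonneg K)) hd0'.le).trans_eq ?_
    have : (√(d : ℝ))⁻¹ ^ 2 = (d : ℝ)⁻¹ := by rw [inv_pow, Real.sq_sqrt hd0'.le]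
    rw [mul_pow, this, ← mul_assoc]
    congr 1
    field_simp
  have hg : Tendsto (fun d : ℕ => (d : ℂ) * (charFun (μ d : Measure ℝ) ((√d)⁻¹ * t) - 1)) atTop
      (𝓝 (-(t : ℂ) ^ 2 / 2)) := by
    have h3 : Tendsto (fun d : ℕ => (d : ℂ) * (charFun (μ d : Measure ℝ) ((√d)⁻¹ * t) - 1
      + (((√d)⁻¹ * t : ℝ) : ℂ) ^ 2 / 2 * ((∫ x, x ^ 2 ∂(μ d : Measure ℝ) : ℝ) : ℂ)))
      atTop (𝓝 0) := by
      rw [tendsto_zero_iff_norm_tendsto_zero]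
      simpa using hsmall
    have h4 : Tendsto (fun d : ℕ => (t : ℂ) ^ 2 / 2 * ((∫ x, x ^ 2 ∂(μ d : Measure ℝ) : ℝ) : ℂ))
        atTop (𝓝 ((t : ℂ) ^ 2 / 2 * ((1 : ℝ) : ℂ))) :=
      ((Complex.continuous_ofReal.tendsto 1).comp hvar).const_mul _
    have h5 := h3.sub h4
    rw [zero_sub, Complex.ofReal_one, mul_one, ← neg_div] at h5
    refine h5.congr' ?_
    filter_upwards [eventually_gt_atTop 0] with d hd
    have hd0' : (0 : ℝ) < d := by exact_mod_cast hd
    have e : (((√(d : ℝ))⁻¹ * t : ℝ) : ℂ) ^ 2 = (d : ℂ)⁻¹ * (t : ℂ) ^ 2 := by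
      rw [← Complex.ofReal_pow, mul_pow, inv_pow, Real.sq_sqrt hd0'.le]
      push_cast
      ring
    have hd1 : (d : ℂ) ≠ 0 := by exact_mod_cast hd.ne'
    rw [e]
    field_simp
    ring
  simpa using Complex.tendsto_one_add_pow_exp_of_tendsto hg

/-! ### Off-diagonal sums of one row -/

/-- The sum of `x i * x k` over the pairs of distinct indices `i, k < n`. -/
noncomputable def offDiagSum (n : ℕ) (x : ℕ → ℝ) : ℝ :=
  (∑ i ∈ Finset.range n, x i) ^ 2 - ∑ i ∈ Finset.range n, x i ^ 2

theorem measurable_offDiagSum (n : ℕ) : Measurable (offDiagSum n) := by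
  unfold offDiagSum
  fun_prop

theorem offDiagSum_succ (n : ℕ) (x : ℕ → ℝ) :
    offDiagSum (n + 1) x = offDiagSum n x + 2 * ((∑ i ∈ Finset.range n, x i) * x n) := by
  simp only [offDiagSum, Finset.sum_range_succ]
  ring

section Moments

variable {Ω : Type*} [MeasurableSpace Ω] {P : Measure Ω} {X : ℕ → Ω → ℝ}

/-- The pair is a function of the first n variables alone. Joint independence is needed for the
product of the two components in the variance recursion. -/
theorem ProbabilityTheory.iIndepFun.indepFun_sum_offDiagSum (hX : iIndepFun X P)
    (hm : ∀ i, Measurable (X i)) (n : ℕ) :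
    IndepFun (fun ω => (∑ i ∈ Finset.range n, X i ω, offDiagSum n fun i => X i ω)) (X n) P := by
  have h := hX.indepFun_finset (Finset.range n) {n} (by simp) hm
  have hψ : Measurable fun y : ({n} : Finset ℕ) → ℝ => y ⟨n, by simp⟩ := measurable_pi_apply _
  have h2 := h.comp
    (φ := fun y : Finset.range n → ℝ => (∑ i, y i, (∑ i, y i) ^ 2 - ∑ i, y i ^ 2))
    (by fun_prop) hψ
  convert! h2 using 2 with ω
  simp only [offDiagSum, Function.comp_apply]
  rw [Finset.sum_coe_sort (Finset.range n) (fun i => X i ω),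
    Finset.sum_coe_sort (Finset.range n) (fun i => X i ω ^ 2)]

variable [IsProbabilityMeasure P]

/-- The first two moments of the sum and of the off-diagonal sum of standardized independent
random variables. -/
theorem moments_sum_and_offDiagSum (hX : iIndepFun X P) (hm : ∀ i, Measurable (X i))
    (hL2 : ∀ i, MemLp (X i) 2 P) (h0 : ∀ i, ∫ ω, X i ω ∂P = 0) (h1 : ∀ i, ∫ ω, X i ω ^ 2 ∂P = 1)
    (n : ℕ) :
    (MemLp (fun ω => ∑ i ∈ Finset.range n, X i ω) 2 P ∧
      ∫ ω, (∑ i ∈ Finset.range n, X i ω) ^ 2 ∂P = n) ∧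
    MemLp (fun ω => offDiagSum n fun i => X i ω) 2 P ∧
      ∫ ω, offDiagSum n (fun i => X i ω) ∂P = 0 ∧
      ∫ ω, offDiagSum n (fun i => X i ω) ^ 2 ∂P = 2 * n * (n - 1) := by
  induction n with
  | zero => simp [offDiagSum]
  | succ n ih =>
    obtain ⟨⟨hT, hT2⟩, hU, hU0, hU2⟩ := ih
    have hind := hX.indepFun_sum_offDiagSum hm n
    set T : Ω → ℝ := fun ω => ∑ i ∈ Finset.range n, X i ω with hTdef
    set U : Ω → ℝ := fun ω => offDiagSum n fun i => X i ω with hUdef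
    have hTX : IndepFun T (X n) P := hind.comp (φ := Prod.fst) (ψ := id) measurable_fst
      measurable_id
    have hUTX : IndepFun (fun ω => U ω * T ω) (X n) P :=
      hind.comp (φ := fun p : ℝ × ℝ => p.2 * p.1) (ψ := id) (by fun_prop) measurable_id
    have hTX2 : IndepFun (fun ω => T ω ^ 2) (fun ω => X n ω ^ 2) P :=
      hTX.comp (φ := fun x => x ^ 2) (ψ := fun x => x ^ 2) (by fun_prop) (by fun_prop)
    have iT := hT.integrable (q := 2) (by norm_num)
    have iX := (hL2 n).integrable (q := 2) (by norm_num)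
    have iU := hU.integrable (q := 2) (by norm_num)
    have iT2 := hT.integrable_sq
    have iX2 := (hL2 n).integrable_sq
    have iU2 := hU.integrable_sq
    have iTX : Integrable (fun ω => T ω * X n ω) P := hTX.integrable_mul iT iX
    have iTX2 : Integrable (fun ω => T ω ^ 2 * X n ω ^ 2) P := hTX2.integrable_mul iT2 iX2
    -- Square integrability of the product comes from independence, not from fourth moments.
    have mTX : MemLp (fun ω => T ω * X n ω) 2 P :=
      (memLp_two_iff_integrable_sq iTX.aestronglyMeasurable).2 (by simpa only [mul_pow] using iTX2)
    have iUT : Integrable (fun ω => U ω * T ω) P := hU.integrable_mul hT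
    have iUTX : Integrable (fun ω => U ω * T ω * X n ω) P := hUTX.integrable_mul iUT iX
    have eTX : ∫ ω, T ω * X n ω ∂P = 0 := by
      rw [hTX.integral_fun_mul_eq_mul_integral iT.aestronglyMeasurable iX.aestronglyMeasurable,
        h0 n, mul_zero]
    have eTX2 : ∫ ω, T ω ^ 2 * X n ω ^ 2 ∂P = n := by
      rw [hTX2.integral_fun_mul_eq_mul_integral iT2.aestronglyMeasurable iX2.aestronglyMeasurable,
        h1 n, mul_one, hT2]
    have eUTX : ∫ ω, U ω * T ω * X n ω ∂P = 0 := by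
      rw [hUTX.integral_fun_mul_eq_mul_integral iUT.aestronglyMeasurable iX.aestronglyMeasurable,
        h0 n, mul_zero]
    have hTs (ω : Ω) : ∑ i ∈ Finset.range (n + 1), X i ω = T ω + X n ω :=
      Finset.sum_range_succ _ _
    have hUs (ω : Ω) : offDiagSum (n + 1) (fun i => X i ω) = U ω + 2 * (T ω * X n ω) :=
      offDiagSum_succ _ _
    simp only [hTs, hUs]
    refine ⟨⟨hT.add (hL2 n), ?_⟩, hU.add (mTX.const_mul 2), ?_, ?_⟩
    · have e : ∀ ω, (T ω + X n ω) ^ 2 = T ω ^ 2 + (2 * (T ω * X n ω) + X n ω ^ 2) :=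
        fun ω => by ring
      have iR : Integrable (fun ω => 2 * (T ω * X n ω) + X n ω ^ 2) P :=
        (iTX.const_mul 2).add iX2
      simp only [e]
      rw [integral_add iT2 iR, integral_add (iTX.const_mul 2) iX2,
        integral_const_mul, hT2, eTX, h1 n]
      push_cast
      ring
    · rw [integral_add iU (iTX.const_mul 2), integral_const_mul, eTX, hU0]
      ring
    -- The cross term has mean zero, so the variance grows by 4n, and 2n(n-1) + 4n = 2(n+1)n.
    · have e : ∀ ω, (U ω + 2 * (T ω * X n ω)) ^ 2
          = U ω ^ 2 + (4 * (U ω * T ω * X n ω) + 4 * (T ω ^ 2 * X n ω ^ 2)) := fun ω => by ring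
      have iR : Integrable (fun ω => 4 * (U ω * T ω * X n ω) + 4 * (T ω ^ 2 * X n ω ^ 2)) P :=
        (iUTX.const_mul 4).add (iTX2.const_mul 4)
      simp only [e]
      rw [integral_add iU2 iR,
        integral_add (iUTX.const_mul 4) (iTX2.const_mul 4), integral_const_mul, integral_const_mul,
        eUTX, eTX2, hU2]
      push_cast
      ring

/-- The normalized sum equals ((T/√n)² - Q/n)/√2, with T the sum and Q the sum of squares: the
central limit theorem handles the first term, the law of large numbers the second. -/
theorem tendstoInDistribution_offDiagSum (hX : iIndepFun X P)
    (hident : ∀ i, IdentDistrib (X i) (X 0) P P) (h0 : ∫ ω, X 0 ω ∂P = 0)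
    (h1 : ∫ ω, X 0 ω ^ 2 ∂P = 1) :
    TendstoInDistribution (fun (n : ℕ) ω => (√2 * n)⁻¹ * offDiagSum n fun i => X i ω) atTop
      (fun x : ℝ => (√2)⁻¹ * (x ^ 2 - 1)) (fun _ => P) (gaussianReal 0 1) := by
  have hclt := tendstoInDistribution_inv_sqrt_mul_sum (HasLaw.id (μ := gaussianReal 0 1)) h0 h1
    hX hident
  have hi2 : Integrable (fun ω => X 0 ω ^ 2) P := .of_integral_ne_zero (by rw [h1]; norm_num)
  have hlln := strong_law_ae_real (fun i ω => X i ω ^ 2) hi2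
    (fun i j hij => (hX.indepFun hij).comp (φ := fun x => x ^ 2) (ψ := fun x => x ^ 2)
      (by fun_prop) (by fun_prop))
    (fun i => (hident i).comp (u := fun x => x ^ 2) (by fun_prop))
  rw [h1] at hlln
  have hm (n : ℕ) : AEMeasurable (fun ω => (∑ i ∈ Finset.range n, X i ω ^ 2) / n) P :=
    (Finset.aemeasurable_fun_sum _ fun i _ => (hident i).aemeasurable_fst.pow_const 2).div_const _
  have hslln : TendstoInMeasure P (fun (n : ℕ) ω => (∑ i ∈ Finset.range n, X i ω ^ 2) / n) atTop
      (fun _ => (1 : ℝ)) :=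
    tendstoInMeasure_of_tendsto_ae (fun n => (hm n).aestronglyMeasurable) hlln
  have h := hclt.continuous_comp_prodMk_of_tendstoInMeasure_const
    (g := fun p : ℝ × ℝ => (√2)⁻¹ * (p.1 ^ 2 - p.2)) (by fun_prop) hslln hm
  convert! h using 3 with n ω
  rw [offDiagSum, mul_pow, inv_pow, Real.sq_sqrt (Nat.cast_nonneg n), mul_inv]
  ring

end Moments

/-! ### Moments of the limit law of one row -/

theorem integral_pow_four_gaussianReal : ∫ x, x ^ 4 ∂(gaussianReal 0 1) = 3 := by
  have h := iteratedDeriv_mgf_zero (X := id) (μ := gaussianReal 0 1) (by simp) 4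
  rw [mgf_id_gaussianReal] at h
  simp only [Pi.pow_apply, id_eq] at h
  rw [← h]
  -- Differentiating p(t)e^{t²/2} replaces p by p' + tp; four applications starting from p = 1 give
  -- the value 3 at t = 0.
  have key (p p' : ℝ → ℝ) (hp : ∀ t, HasDerivAt p (p' t) t) :
      deriv (fun t => p t * Real.exp (t ^ 2 / 2))
        = fun t => (p' t + t * p t) * Real.exp (t ^ 2 / 2) := by
    ext t
    have h2 : HasDerivAt (fun t : ℝ => t ^ 2 / 2) t t := by
      convert! (hasDerivAt_pow 2 t).div_const 2 using 1
      simp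
    refine ((hp t).mul h2.exp).deriv.trans ?_
    ring
  have e0 : (fun t : ℝ => Real.exp (0 * t + ((1 : NNReal) : ℝ) * t ^ 2 / 2))
      = fun t => 1 * Real.exp (t ^ 2 / 2) := by
    ext t
    simp
  rw [e0]
  simp only [iteratedDeriv_succ, iteratedDeriv_zero]
  rw [key (fun _ => 1) (fun _ => 0) (fun t => hasDerivAt_const t _),
    key (fun t => 0 + t * 1) (fun _ => 1) (fun t => by simpa using hasDerivAt_id' t),
    key (fun t => 1 + t * (0 + t * 1)) (fun t => 2 * t) (fun t => by
      convert! ((hasDerivAt_pow 2 t).const_add 1) using 1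
      · ext t; ring
      · simp),
    key (fun t => 2 * t + t * (1 + t * (0 + t * 1))) (fun t => 3 + 3 * t ^ 2) (fun t => by
      convert! ((hasDerivAt_id' t).const_mul 3).add (hasDerivAt_pow 3 t) using 1
      · ext t; simp; ring
      · simp)]
  simp

theorem memLp_sq_sub_one_gaussianReal :
    MemLp (fun x : ℝ => (√2)⁻¹ * (x ^ 2 - 1)) 2 (gaussianReal 0 1) := by
  have h4 : Integrable (fun x : ℝ => x ^ 4) (gaussianReal 0 1) :=
    .of_integral_ne_zero (by rw [integral_pow_four_gaussianReal]; norm_num)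
  refine MemLp.const_mul (MemLp.sub ?_ (memLp_const 1)) _
  rw [memLp_two_iff_integrable_sq (Continuous.aestronglyMeasurable (by fun_prop))]
  simpa only [← pow_mul] using h4

theorem integral_sq_sub_one_gaussianReal :
    ∫ x, ((√2)⁻¹ * (x ^ 2 - 1)) ^ 2 ∂(gaussianReal 0 1) = 1 := by
  have h4 : Integrable (fun x : ℝ => x ^ 4) (gaussianReal 0 1) :=
    .of_integral_ne_zero (by rw [integral_pow_four_gaussianReal]; norm_num)
  have h2 : Integrable (fun x : ℝ => x ^ 2) (gaussianReal 0 1) :=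
    (memLp_id_gaussianReal 2).integrable_sq
  have hv : ∫ x, x ^ 2 ∂(gaussianReal 0 1) = 1 := by
    have := variance_of_integral_eq_zero (X := fun x : ℝ => x) (μ := gaussianReal 0 1)
      aemeasurable_id integral_id_gaussianReal
    rw [variance_fun_id_gaussianReal] at this
    simpa using this.symm
  have e (x : ℝ) : ((√2)⁻¹ * (x ^ 2 - 1)) ^ 2 = 1 / 2 * (x ^ 4 - (2 * x ^ 2 - 1)) := by
    rw [mul_pow, inv_pow, Real.sq_sqrt (by norm_num)]
    ring
  have hR : Integrable (fun x : ℝ => 2 * x ^ 2 - 1) (gaussianReal 0 1) :=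
    (h2.const_mul 2).sub (integrable_const _)
  simp only [e]
  rw [integral_const_mul, integral_sub h4 hR,
    integral_sub (h2.const_mul 2) (integrable_const _), integral_const_mul, hv,
    integral_pow_four_gaussianReal]
  simp
  norm_num

/-! ### Asymptotic normality of the off-diagonal part -/

/-- The law of an array of independent copies with common law `μ`, stored row by row. -/
noncomputable abbrev iidArrayLaw (μ : Measure ℝ) [IsProbabilityMeasure μ] : Measure (ℕ → ℕ → ℝ) :=
  Measure.infinitePi fun _ => Measure.infinitePi fun _ => μ

/-- In the model array the coordinate index comes first and the step index second, hence the swap;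
each coordinate of the walk is then one factor of the outer product. -/
theorem iIndepFun_iidArrayLaw (μ : Measure ℝ) [IsProbabilityMeasure μ] :
    iIndepFun (fun (p : ℕ × ℕ) (ω : ℕ → ℕ → ℝ) => ω p.2 p.1) (iidArrayLaw μ) :=
  (iIndepFun_uncurry_infinitePi' (X := fun (_ _ : ℕ) (x : ℝ) => x) (fun _ _ => μ)
    (fun _ _ => measurable_id)).precomp Prod.swap_injective

theorem map_eval_iidArrayLaw (μ : Measure ℝ) [IsProbabilityMeasure μ] (p : ℕ × ℕ) :
    (iidArrayLaw μ).map (fun ω => ω p.2 p.1) = μ := by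
  have h := Measure.map_map (μ := iidArrayLaw μ) (g := fun x : ℕ → ℝ => x p.1)
    (f := fun ω : ℕ → ℕ → ℝ => ω p.2) (measurable_pi_apply _) (measurable_pi_apply _)
  rw [Measure.infinitePi_map_eval, Measure.infinitePi_map_eval] at h
  exact h.symm

/-- The normalized sum of the off-diagonal sums of the first `d` rows is asymptotically normal. -/
theorem tendstoInDistribution_sum_offDiagSum_iidArrayLaw (μ : Measure ℝ) [IsProbabilityMeasure μ]
    (h0 : ∫ x, x ∂μ = 0) (h1 : ∫ x, x ^ 2 ∂μ = 1) {n : ℕ → ℕ} (hn : Tendsto n atTop atTop) :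
    TendstoInDistribution
      (fun (d : ℕ) (ω : ℕ → ℕ → ℝ) =>
        (√d)⁻¹ * ∑ j ∈ Finset.range d, (√2 * n d)⁻¹ * offDiagSum (n d) (ω j))
      atTop (id : ℝ → ℝ) (fun _ => iidArrayLaw μ) (gaussianReal 0 1) := by
  set Q := iidArrayLaw μ
  let V (m : ℕ) (x : ℕ → ℝ) : ℝ := (√2 * m)⁻¹ * offDiagSum m x
  have hV (m : ℕ) : Measurable (V m) := (measurable_offDiagSum m).const_mul _
  -- All rows share one law, so moments and limits are computed on row 0.
  let X (i : ℕ) (ω : ℕ → ℕ → ℝ) : ℝ := ω 0 i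
  have hXm (i : ℕ) : Measurable (X i) := by fun_prop
  have hXlaw (i : ℕ) : Q.map (X i) = μ := map_eval_iidArrayLaw μ (i, 0)
  have hXind : iIndepFun X Q :=
    (iIndepFun_iidArrayLaw μ).precomp (g := fun i : ℕ => (i, 0)) fun i j h => by simpa using h
  have hXident (i : ℕ) : IdentDistrib (X i) (X 0) Q Q :=
    ⟨(hXm i).aemeasurable, (hXm 0).aemeasurable, by rw [hXlaw, hXlaw]⟩
  have hX0 (i : ℕ) : ∫ ω, X i ω ∂Q = 0 := by
    rw [← h0, ← hXlaw i, integral_map (hXm i).aemeasurable (by fun_prop)]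
  have hX1 (i : ℕ) : ∫ ω, X i ω ^ 2 ∂Q = 1 := by
    rw [← h1, ← hXlaw i, integral_map (hXm i).aemeasurable (by fun_prop)]
  have hX2 (i : ℕ) : MemLp (X i) 2 Q :=
    (memLp_two_iff_integrable_sq (hXm i).aestronglyMeasurable).2
      (.of_integral_ne_zero (by rw [hX1]; norm_num))
  have hmom (m : ℕ) := (moments_sum_and_offDiagSum hXind hXm hX2 hX0 hX1 m).2
  have hrow (m j : ℕ) :
      Q.map (fun ω => V m (ω j)) = (Measure.infinitePi fun _ : ℕ => μ).map (V m) := by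
    have h := Measure.map_map (μ := Q) (g := V m)
      (f := fun ω : ℕ → ℕ → ℝ => ω j) (hV m) (measurable_pi_apply _)
    rw [Measure.infinitePi_map_eval] at h
    exact h.symm
  have hVm (m j : ℕ) : Measurable fun ω : ℕ → ℕ → ℝ => V m (ω j) :=
    (hV m).comp (measurable_pi_apply j)
  have hind (m : ℕ) : iIndepFun (fun (j : ℕ) (ω : ℕ → ℕ → ℝ) => V m (ω j)) Q :=
    iIndepFun_infinitePi (X := fun _ => V m) fun _ => hV m
  have hident (m j : ℕ) :
      IdentDistrib (fun ω : ℕ → ℕ → ℝ => V m (ω j)) (fun ω => V m (ω 0)) Q Q :=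
    ⟨(hVm m j).aemeasurable, (hVm m 0).aemeasurable, by rw [hrow, hrow]⟩
  have hlim := (tendstoInDistribution_offDiagSum hXind hXident (hX0 0) (hX1 0)).comp_tendsto hn
  refine ⟨fun d => Measurable.aemeasurable ?_, aemeasurable_id, ?_⟩
  · exact (Finset.measurable_fun_sum _ fun j _ => hVm (n d) j).const_mul _
  refine ProbabilityMeasure.tendsto_iff_tendsto_charFun.2 fun t => ?_
  have hclt := tendsto_charFun_pow_of_tendsto hlim.tendsto ?_ ?_ ?_ ?_ ?_ t
  · simp only [ProbabilityMeasure.coe_mk, Measure.map_id, charFun_gaussianReal] at hclt ⊢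
    convert! hclt using 2 with d
    · exact charFun_inv_sqrt_mul_sum (hind (n d)) (hident (n d))
    · congr 1
      simp
      ring
  · intro d
    exact (memLp_map_measure_iff (by fun_prop) (hVm (n d) 0).aemeasurable).2
      ((hmom (n d)).1.const_mul _)
  · intro d
    refine (integral_map (hVm (n d) 0).aemeasurable (by fun_prop)).trans ?_
    refine (integral_const_mul _ _).trans ?_
    rw [(hmom (n d)).2.1, mul_zero]
  -- The second moment of a normalized row is 2n(n-1)/(2n²) = 1 - 1/n.
  · have hlim1 : Tendsto (fun d => 1 - ((n d : ℝ))⁻¹) atTop (𝓝 (1 - 0)) :=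
      (tendsto_inv_atTop_zero.comp (tendsto_natCast_atTop_atTop.comp hn)).const_sub 1
    rw [sub_zero] at hlim1
    refine hlim1.congr' ?_
    filter_upwards [hn.eventually_gt_atTop 0] with d hd
    have hd' : (n d : ℝ) ≠ 0 := by exact_mod_cast hd.ne'
    symm
    refine (integral_map (hVm (n d) 0).aemeasurable (by fun_prop)).trans ?_
    simp only [V, mul_pow]
    refine (integral_const_mul _ _).trans ?_
    rw [(hmom (n d)).2.2, inv_pow, mul_pow, Real.sq_sqrt (by norm_num)]
    field_simp
  · exact (memLp_map_measure_iff (by fun_prop) (by fun_prop)).2 memLp_sq_sub_one_gaussianReal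
  · exact (integral_map (by fun_prop) (by fun_prop)).trans integral_sq_sub_one_gaussianReal

section Copies

variable {Ω₀ Ω₁ Ω : Type*} [MeasurableSpace Ω₀] [MeasurableSpace Ω₁] [MeasurableSpace Ω]
  {P₀ : Measure Ω₀} {P₁ : Measure Ω₁} {P : Measure Ω} {ξ₀ : Ω₀ → ℝ} {ξ : ℕ × ℕ → Ω → ℝ}

/-- Only the joint law of the array matters, so the result transfers from the product model, where
independence of the rows is built in. -/
theorem IndependentCopies.tendstoInDistribution_sum_offDiagSum [IsProbabilityMeasure P₀]
    [IsProbabilityMeasure P] (hξ : IndependentCopies ξ P ξ₀ P₀) (h0 : ∫ ω, ξ₀ ω ∂P₀ = 0)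
    (h1 : ∫ ω, ξ₀ ω ^ 2 ∂P₀ = 1) {n : ℕ → ℕ} (hn : Tendsto n atTop atTop) :
    TendstoInDistribution
      (fun (d : ℕ) ω =>
        (√d)⁻¹ * ∑ j ∈ Finset.range d, (√2 * n d)⁻¹ * offDiagSum (n d) fun i => ξ (i, j) ω)
      atTop (id : ℝ → ℝ) (fun _ => P) (gaussianReal 0 1) := by
  have hm := (hξ.identDistrib 0).aemeasurable_snd
  have : IsProbabilityMeasure (P₀.map ξ₀) := Measure.isProbabilityMeasure_map hm
  have hQ := tendstoInDistribution_sum_offDiagSum_iidArrayLaw (P₀.map ξ₀)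
    (by rwa [integral_map hm (by fun_prop)]) (by rwa [integral_map hm (by fun_prop)]) hn
  have harray : IdentDistrib (fun ω p => ξ p ω) (fun (ω : ℕ → ℕ → ℝ) (p : ℕ × ℕ) => ω p.2 p.1) P
      (iidArrayLaw (P₀.map ξ₀)) :=
    IdentDistrib.pi (fun p => ⟨(hξ.identDistrib p).aemeasurable_fst,
      Measurable.aemeasurable (by fun_prop), by
        rw [map_eval_iidArrayLaw, (hξ.identDistrib p).map_eq]⟩) hξ.indep (iIndepFun_iidArrayLaw _)
  refine hQ.of_map_eq fun d => ?_
  refine harray.comp (u := fun x : ℕ × ℕ → ℝ =>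
    (√d)⁻¹ * ∑ j ∈ Finset.range d, (√2 * n d)⁻¹ * offDiagSum (n d) fun i => x (i, j)) ?_
  refine (Finset.measurable_fun_sum _ fun j _ => Measurable.const_mul ?_ _).const_mul _
  exact (measurable_offDiagSum _).comp (by fun_prop)

/-- Reindexing the nd entries as a single sequence makes the attraction hypothesis, given for `η`,
available for the array at m = nd. -/
theorem IndependentCopies.identDistrib_sum_sq {η : ℕ → Ω₁ → ℝ} (hξ : IndependentCopies ξ P ξ₀ P₀)
    (hη : IndependentCopies η P₁ ξ₀ P₀) (n d : ℕ) :
    IdentDistrib (fun ω => ∑ j ∈ Finset.range d, ∑ i ∈ Finset.range n, ξ (i, j) ω ^ 2)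
      (fun ω => ∑ k ∈ Finset.range (n * d), η k ω ^ 2) P P₁ := by
  let e : Fin (n * d) ≃ Fin n × Fin d := finProdFinEquiv.symm
  let g (k : Fin (n * d)) : ℕ × ℕ := ((e k).1, (e k).2)
  have hg : Function.Injective g := fun k l h => by
    simp only [g, Prod.mk.injEq, Fin.val_inj] at h
    exact e.injective (Prod.ext h.1 h.2)
  have h := IdentDistrib.pi (X := fun k => ξ (g k)) (Y := fun k : Fin (n * d) => η k)
    (fun k => (hξ.identDistrib _).trans (hη.identDistrib _).symm) (hξ.indep.precomp hg)
    (hη.indep.precomp Fin.val_injective)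
  convert! h.comp (u := fun x : Fin (n * d) → ℝ => ∑ k, x k ^ 2) (by fun_prop) using 2 with ω ω
  · simp only [Function.comp_apply, g]
    rw [e.sum_comp (fun p => ξ (p.1, p.2) ω ^ 2), Fintype.sum_prod_type, Finset.sum_comm]
    simp only [Finset.sum_range]
  · simp only [Function.comp_apply, Finset.sum_range]

end Copies

/-! ### Splitting the squared norm and comparing the two normings -/

theorem norm_walk_sq {Ω : Type*} (ξ : ℕ × ℕ → Ω → ℝ) {d : ℕ} (hd : d ≠ 0) (n : ℕ) (ω : Ω) :
    ‖walk ξ d n ω‖ ^ 2 - n =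
      (d : ℝ)⁻¹ * ((∑ j ∈ Finset.range d, ∑ i ∈ Finset.range n, ξ (i, j) ω ^ 2 - (n * d : ℕ))
        + ∑ j ∈ Finset.range d, offDiagSum n fun i => ξ (i, j) ω) := by
  have hd' : (d : ℝ) ≠ 0 := by exact_mod_cast hd
  have h1 : ‖walk ξ d n ω‖ ^ 2
      = ∑ j ∈ Finset.range d, (d : ℝ)⁻¹ * (∑ i ∈ Finset.range n, ξ (i, j) ω) ^ 2 := by
    rw [EuclideanSpace.real_norm_sq_eq, Finset.sum_range]
    refine Finset.sum_congr rfl fun j _ => ?_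
    simp only [walk, increment, WithLp.ofLp_sum, Finset.sum_apply]
    rw [← Finset.sum_div, div_pow, Real.sq_sqrt (Nat.cast_nonneg d)]
    ring
  rw [h1, ← Finset.mul_sum]
  simp only [offDiagSum, Finset.sum_sub_distrib]
  push_cast
  field_simp
  ring

theorem eventually_stableNorming_pos {L : ℝ → ℝ} (hL : IsSlowlyVarying L) (β : ℝ) {N : ℕ → ℝ}
    (hN : Tendsto N atTop atTop) : ∀ᶠ d in atTop, 0 < N d ^ β * L (N d) := by
  filter_upwards [hN.eventually (hL.eventually_rpow_bounds one_pos), hN.eventually_gt_atTop 0]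
    with d h1 h0
  exact mul_pos (Real.rpow_pos_of_pos h0 _) ((Real.rpow_pos_of_pos h0 _).trans_le h1.1)

section Norming

variable {α δ : ℝ} {L : ℝ → ℝ} {n : ℕ → ℕ}

/-- Above the critical number of steps, the stable norming is negligible with respect to the
Gaussian norming. -/
theorem tendsto_stableNorming_div_gaussianNorming (hα : α ∈ Set.Ioo (1 : ℝ) 2)
    (hL : IsSlowlyVarying L) (hδ : 0 < δ)
    (hgrow : Tendsto (fun d : ℕ => (n d : ℝ) * (d : ℝ)) atTop atTop)
    (hnd : ∀ᶠ d : ℕ in atTop, (d : ℝ) ^ ((2 - α) / (2 * α - 2) + δ) < (n d : ℝ)) :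
    Tendsto (fun d : ℕ => ((n d : ℝ) * (d : ℝ)) ^ (1 / α) * L ((n d : ℝ) * (d : ℝ))
      / (√2 * n d * √d)) atTop (𝓝 0) := by
  obtain ⟨hα1, hα2⟩ := hα
  set p := (2 - α) / (2 * α - 2) with hp
  have hp0 : 0 < p := div_pos (by linarith) (by linarith)
  set κ := 1 - 1 / α with hκdef
  have hκ : 0 < κ := sub_pos.2 ((div_lt_one (by linarith)).2 hα1)
  -- This identity says that the powers of n and d in the two normings balance at n = d^p.
  have hpκ : p * κ = 1 / α - 1 / 2 := by
    have h1 : 2 * α - 2 ≠ 0 := by linarith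
    have h2 : α ≠ 0 := by linarith
    have h3 : α - 1 ≠ 0 := by linarith
    rw [hp, hκdef]
    field_simp
  -- The final exponent of d is -δκ + ε(p + δ + 1); this choice lets the slowly varying factor cost
  -- exactly half the gain.
  set ε := δ * κ / (2 * (p + δ + 1)) with hεdef
  have hε : 0 < ε := by positivity
  have hε2 : ε * (p + δ + 1) = δ * κ / 2 := by
    rw [hεdef]
    field_simp
  -- Keeps the exponent of n negative, so that the lower bound on n gives an upper bound.
  have hεκ : ε < κ := by nlinarith [mul_pos hε hp0, mul_pos hδ hκ]
  have hlim : Tendsto (fun d : ℕ => (d : ℝ) ^ (-(δ * κ / 2))) atTop (𝓝 0) :=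
    (tendsto_rpow_neg_atTop (by positivity)).comp tendsto_natCast_atTop_atTop
  refine squeeze_zero' ?_ ?_ hlim
  · filter_upwards [eventually_stableNorming_pos hL (1 / α) hgrow] with d hd
    positivity
  filter_upwards [hnd, hgrow.eventually (hL.eventually_rpow_bounds hε), eventually_ge_atTop 1]
    with d hnd hLd hd1
  have hd : (1 : ℝ) ≤ d := by exact_mod_cast hd1
  have hd0 : (0 : ℝ) < d := by linarith
  have hn0 : (0 : ℝ) < n d := (Real.rpow_pos_of_pos hd0 _).trans hnd
  have hn1 : (n d : ℝ) ^ (-(κ - ε)) ≤ (d : ℝ) ^ ((p + δ) * -(κ - ε)) := by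
    rw [Real.rpow_mul hd0.le]
    exact Real.rpow_le_rpow_of_nonpos (Real.rpow_pos_of_pos hd0 _) hnd.le (by linarith)
  have hs2 : 1 ≤ √(2 : ℝ) := Real.one_le_sqrt.2 (by norm_num)
  rw [div_le_iff₀ (by positivity)]
  calc ((n d : ℝ) * d) ^ (1 / α) * L (n d * d)
      ≤ ((n d : ℝ) * d) ^ (1 / α) * ((n d : ℝ) * d) ^ ε := by gcongr; exact hLd.2
    _ = n d * (n d : ℝ) ^ (-(κ - ε)) * (d : ℝ) ^ (1 / α + ε) := by
        rw [← Real.rpow_add (by positivity), Real.mul_rpow hn0.le hd0.le]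
        congr 1
        nth_rw 2 [← Real.rpow_one (n d : ℝ)]
        rw [← Real.rpow_add hn0]
        congr 1
        rw [hκdef]
        ring
    _ ≤ n d * (d : ℝ) ^ ((p + δ) * -(κ - ε)) * (d : ℝ) ^ (1 / α + ε) := by gcongr
    _ = (d : ℝ) ^ (-(δ * κ / 2)) * (1 * n d * √d) := by
        rw [Real.sqrt_eq_rpow, mul_assoc, ← Real.rpow_add hd0, one_mul, mul_left_comm,
          ← Real.rpow_add hd0]
        congr 2
        linear_combination hε2 - hpκ
    _ ≤ (d : ℝ) ^ (-(δ * κ / 2)) * (√2 * n d * √d) := by gcongr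

/-- Below the critical number of steps, the Gaussian norming is negligible with respect to the
stable norming. -/
theorem tendsto_gaussianNorming_div_stableNorming (hα : α ∈ Set.Ioo (1 : ℝ) 2)
    (hL : IsSlowlyVarying L) (hδ : 0 < δ)
    (hgrow : Tendsto (fun d : ℕ => (n d : ℝ) * (d : ℝ)) atTop atTop)
    (hnd : ∀ᶠ d : ℕ in atTop, (n d : ℝ) < (d : ℝ) ^ ((2 - α) / (2 * α - 2) - δ)) :
    Tendsto (fun d : ℕ => √2 * n d * √d
      / (((n d : ℝ) * (d : ℝ)) ^ (1 / α) * L ((n d : ℝ) * (d : ℝ)))) atTop (𝓝 0) := by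
  obtain ⟨hα1, hα2⟩ := hα
  set p := (2 - α) / (2 * α - 2) with hp
  have hp0 : 0 < p := div_pos (by linarith) (by linarith)
  set κ := 1 - 1 / α with hκdef
  have hκ : 0 < κ := sub_pos.2 ((div_lt_one (by linarith)).2 hα1)
  have hpκ : p * κ = 1 / α - 1 / 2 := by
    have h1 : 2 * α - 2 ≠ 0 := by linarith
    have h2 : α ≠ 0 := by linarith
    have h3 : α - 1 ≠ 0 := by linarith
    rw [hp, hκdef]
    field_simp
  -- Here the exponent of d is -δκ + ε(p + 1) - δε; the last term only helps and is dropped since d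
  -- ≥ 1.
  set ε := δ * κ / (2 * (p + 1)) with hεdef
  have hε : 0 < ε := by positivity
  have hε2 : ε * (p + 1) = δ * κ / 2 := by
    rw [hεdef]
    field_simp
  have hlim : Tendsto (fun d : ℕ => √2 * (d : ℝ) ^ (-(δ * κ / 2))) atTop (𝓝 (√2 * 0)) :=
    ((tendsto_rpow_neg_atTop (by positivity)).comp tendsto_natCast_atTop_atTop).const_mul _
  rw [mul_zero] at hlim
  refine squeeze_zero' ?_ ?_ hlim
  · filter_upwards [eventually_stableNorming_pos hL (1 / α) hgrow] with d hd
    positivity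
  filter_upwards [hnd, hgrow.eventually (hL.eventually_rpow_bounds hε), eventually_ge_atTop 1,
    hgrow.eventually_gt_atTop 0, eventually_stableNorming_pos hL (1 / α) hgrow]
    with d hnd hLd hd1 hN0 hpos
  have hd : (1 : ℝ) ≤ d := by exact_mod_cast hd1
  have hd0 : (0 : ℝ) < d := by linarith
  have hn0 : (0 : ℝ) < n d := pos_of_mul_pos_left hN0 hd0.le
  have hn1 : (n d : ℝ) ^ (κ + ε) ≤ (d : ℝ) ^ ((p - δ) * (κ + ε)) := by
    rw [Real.rpow_mul hd0.le]
    exact Real.rpow_le_rpow hn0.le hnd.le (by linarith)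
  rw [div_le_iff₀ hpos, mul_assoc, mul_assoc]
  gcongr √2 * ?_
  calc (n d : ℝ) * √d
      = (n d : ℝ) ^ (κ + ε) * (d : ℝ) ^ (1 / 2 - (1 / α - ε))
          * ((n d : ℝ) * d) ^ (1 / α - ε) := by
        rw [Real.mul_rpow hn0.le hd0.le, mul_mul_mul_comm, ← Real.rpow_add hn0,
          ← Real.rpow_add hd0, Real.sqrt_eq_rpow]
        congr 1
        · nth_rw 1 [← Real.rpow_one (n d : ℝ)]
          congr 1
          rw [hκdef]
          ring
        · congr 1
          ring
    _ ≤ (d : ℝ) ^ ((p - δ) * (κ + ε)) * (d : ℝ) ^ (1 / 2 - (1 / α - ε))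
          * ((n d : ℝ) * d) ^ (1 / α - ε) := by gcongr
    _ = (d : ℝ) ^ (-(δ * κ / 2) - δ * ε) * ((n d : ℝ) * d) ^ (1 / α - ε) := by
        rw [← Real.rpow_add hd0]
        congr 2
        linear_combination hε2 + hpκ
    _ ≤ (d : ℝ) ^ (-(δ * κ / 2)) * ((n d : ℝ) * d) ^ (1 / α - ε) := by
        gcongr
        linarith [mul_pos hδ hε]
    _ = (d : ℝ) ^ (-(δ * κ / 2)) * (((n d : ℝ) * d) ^ (1 / α) * ((n d : ℝ) * d) ^ (-ε)) := by
        rw [← Real.rpow_add hN0, sub_eq_add_neg]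
    _ ≤ (d : ℝ) ^ (-(δ * κ / 2)) * (((n d : ℝ) * d) ^ (1 / α) * L (n d * d)) := by
        gcongr
        exact hLd.1

end Norming

/-! ### The two regimes -/

theorem mainTheorem8
    {Ω₀ Ω₁ Ω Ω' : Type*} [MeasurableSpace Ω₀] [MeasurableSpace Ω₁] [MeasurableSpace Ω]
    [MeasurableSpace Ω'] (P₀ : Measure Ω₀) (P₁ : Measure Ω₁) (P : Measure Ω) (P' : Measure Ω')
    [IsProbabilityMeasure P₀] [IsProbabilityMeasure P₁] [IsProbabilityMeasure P]
    [IsProbabilityMeasure P']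
    -- the generic random variable `ξ`, with mean `0` and variance `1`
    (ξ₀ : Ω₀ → ℝ) (hmeas : AEMeasurable ξ₀ P₀)
    (hmean : ∫ ω, ξ₀ ω ∂P₀ = 0) (hvar : ∫ ω, ξ₀ ω ^ 2 ∂P₀ = 1)
    -- the array of independent copies of `ξ` that defines the random walks
    (ξ : ℕ × ℕ → Ω → ℝ) (hξ : IndependentCopies ξ P ξ₀ P₀)
    -- the stable limit and the slowly varying function
    (α : ℝ) (hα : α ∈ Set.Ioo (1 : ℝ) 2) (L : ℝ → ℝ) (hL : IsSlowlyVarying L)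
    (ζ : Ω' → ℝ) (hζ : AEMeasurable ζ P') (hstable : IsSpectrallyPositiveStable α (P'.map ζ))
    (hζint : Integrable ζ P') (hζmean : ∫ ω, ζ ω ∂P' = 0)
    -- `ξ²` is in the domain of attraction of the law of `ζ`
    (η : ℕ → Ω₁ → ℝ) (hη : IndependentCopies η P₁ ξ₀ P₀)
    (hattr : TendstoInDistribution
      (fun (m : ℕ) ω =>
        ((∑ k ∈ Finset.range m, η k ω ^ 2) - (m : ℝ)) / ((m : ℝ) ^ (1 / α) * L (m : ℝ)))
      atTop ζ (fun _ => P₁) P')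
    -- the number of steps
    (n : ℕ → ℕ) (hn : Tendsto n atTop atTop) :
    ((∃ δ : ℝ, 0 < δ ∧
        ∀ᶠ d : ℕ in atTop, (d : ℝ) ^ ((2 - α) / (2 * α - 2) + δ) < (n d : ℝ)) →
      TendstoInDistribution
        (fun (d : ℕ) ω => (‖walk ξ d (n d) ω‖ ^ 2 - (n d : ℝ)) / √(2 * (n d : ℝ) ^ 2 / (d : ℝ)))
        atTop (id : ℝ → ℝ) (fun _ => P) (gaussianReal 0 1)) ∧
    ((∃ δ : ℝ, 0 < δ ∧
        ∀ᶠ d : ℕ in atTop, (n d : ℝ) < (d : ℝ) ^ ((2 - α) / (2 * α - 2) - δ)) →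
      TendstoInDistribution
        (fun (d : ℕ) ω => (‖walk ξ d (n d) ω‖ ^ 2 - (n d : ℝ)) /
          ((d : ℝ)⁻¹ * ((n d : ℝ) * (d : ℝ)) ^ (1 / α) * L ((n d : ℝ) * (d : ℝ))))
        atTop ζ (fun _ => P) P') := by
  have hgrow : Tendsto (fun d : ℕ => (n d : ℝ) * (d : ℝ)) atTop atTop :=
    (tendsto_natCast_atTop_atTop.comp hn).atTop_mul_atTop₀ tendsto_natCast_atTop_atTop
  have hgrowNat : Tendsto (fun d : ℕ => n d * d) atTop atTop := hn.atTop_mul_atTop₀ tendsto_id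
  have hwalk (d : ℕ) : AEMeasurable (fun ω => ‖walk ξ d (n d) ω‖ ^ 2 - (n d : ℝ)) P := by
    have hξm (p : ℕ × ℕ) : AEMeasurable (ξ p) P := (hξ.identDistrib p).aemeasurable_fst
    have h : AEMeasurable (fun ω => walk ξ d (n d) ω) P := by
      refine Finset.aemeasurable_fun_sum _ fun i _ => ?_
      exact (WithLp.measurable_toLp 2 _).comp_aemeasurable
        (aemeasurable_pi_lambda _ fun j => (hξm _).div_const _)
    exact (h.norm.pow_const 2).sub_const _
  let A (d : ℕ) (ω : Ω) : ℝ :=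
    ∑ j ∈ Finset.range d, ∑ i ∈ Finset.range (n d), ξ (i, j) ω ^ 2 - (n d * d : ℕ)
  let B (d : ℕ) (ω : Ω) : ℝ := ∑ j ∈ Finset.range d, offDiagSum (n d) fun i => ξ (i, j) ω
  let b (d : ℕ) : ℝ := ((n d : ℝ) * (d : ℝ)) ^ (1 / α) * L ((n d : ℝ) * (d : ℝ))
  have hA : TendstoInDistribution (fun d ω => A d ω / b d) atTop ζ (fun _ => P) P' := by
    refine (hattr.comp_tendsto hgrowNat).of_map_eq fun d => ?_
    have h := (hξ.identDistrib_sum_sq hη (n d) d).comp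
      (u := fun x => (x - (n d * d : ℕ)) / b d) (by fun_prop)
    simpa only [Function.comp_def, Nat.cast_mul, A, b] using h
  have hB := hξ.tendstoInDistribution_sum_offDiagSum hmean hvar hn
  have hBeq (d : ℕ) (ω : Ω) :
      (√(d : ℝ))⁻¹ * ∑ j ∈ Finset.range d, (√2 * n d)⁻¹ * offDiagSum (n d) (fun i => ξ (i, j) ω)
        = B d ω / (√2 * n d * √d) := by
    rw [← Finset.mul_sum, div_eq_inv_mul, mul_inv (√2 * (n d : ℝ)) (√(d : ℝ))]
    ring
  simp only [hBeq] at hB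
  constructor
  · rintro ⟨δ, hδ, hnd⟩
    -- Many steps: B leads, and A, rescaled by its own norming, enters with the vanishing ratio of
    -- normings as coefficient. Below the critical exponent the roles are exchanged.
    refine hB.of_eventually_eq_add_mul hA
      (tendsto_stableNorming_div_gaussianNorming hα hL hδ hgrow hnd)
      (fun d => (hwalk d).div_const _) ?_
    have hb := eventually_stableNorming_pos hL (1 / α) hgrow
    filter_upwards [hb, hn.eventually_gt_atTop 0, eventually_gt_atTop 0] with d hbd hn0 hd0 ω
    have hn0' : (0 : ℝ) < n d := by exact_mod_cast hn0
    have hd0' : (0 : ℝ) < d := by exact_mod_cast hd0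
    have hb0 : b d ≠ 0 := hbd.ne'
    rw [norm_walk_sq ξ hd0.ne', Real.sqrt_div (by positivity), Real.sqrt_mul (by norm_num),
      Real.sqrt_sq hn0'.le]
    change (d : ℝ)⁻¹ * (A d ω + B d ω) / _ = _ + b d / _ * _
    nth_rw 1 [← Real.sq_sqrt hd0'.le]
    field_simp
    ring
  · rintro ⟨δ, hδ, hnd⟩
    refine hA.of_eventually_eq_add_mul hB
      (tendsto_gaussianNorming_div_stableNorming hα hL hδ hgrow hnd)
      (fun d => (hwalk d).div_const _) ?_
    have hb := eventually_stableNorming_pos hL (1 / α) hgrow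
    filter_upwards [hb, hn.eventually_gt_atTop 0, eventually_gt_atTop 0] with d hbd hn0 hd0 ω
    have hn0' : (0 : ℝ) < n d := by exact_mod_cast hn0
    have hd0' : (0 : ℝ) < d := by exact_mod_cast hd0
    have hb0 : b d ≠ 0 := hbd.ne'
    rw [norm_walk_sq ξ hd0.ne', mul_assoc]
    change (d : ℝ)⁻¹ * (A d ω + B d ω) / ((d : ℝ)⁻¹ * b d) = _ + _ / b d * _
    field_simp
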